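/- Let $n\le m$, $\ell\le m$, $t\ge 0$, $m\ge 1$ and $K\ge 1$ be integers, and put $N=2^n$, $L=2^\ell$. Identify $[N]$ with $\{0,1\}^n$ and $[L]$ with $\{0,1\}^\ell$. A $t$-query adversary $A=(n,m,\ell,U_1,\dots,U_{t+1})$ is given by unitaries $U_1,\dots,U_{t+1}$ on $m$ qubits. For $f:[L]\to\{\pm1\}$, let $\mathcal O_f$ be the phase oracle acting on the first $\ell$ qubits by $|x\rangle\mapsto f(x)|x\rangle$. On an $n$-qubit input state $|\psi\rangle$, the adversary $A^f$ prepares $$U_{t+1}\,\mathcal O_f\,U_t\cdots \mathcal O_f\,U_2\,\mathcal O_f\,U_1\,\bigl(|\psi\rangle\otimes|0^{m-n}\rangle\bigr),$$ measures the first qubit in the standard basis, and outputs the resulting bit. For $h:[N]\to\{\pm1\}$ let $|\psi_h\rangle=N^{-1/2}\sum_{x\in[N]}h(x)|x\rangle$. For a function family $R:[K]\times[N]\to\{\pm1\}$, write $R_k=R(k,\cdot)$. In the game $\mathsf{Game}^R$ the challenger draws a uniformly random bit $b$. If $b=0$, it sends $|\psi_{R_k}\rangle$ for a uniformly random $k\in[K]$.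 If $b=1$, it sends $|x\rangle$ for a uniformly random $x\in[N]$. (The state sent when $b=1$ is on average maximally mixed, so one may equivalently send $|\psi_h\rangle$ for a uniformly random $h:[N]\to\{\pm1\}$.) The adversary wins if its output equals $b$. Define $$\Delta_A(R\mid f)=2\,\Bigl|\Pr[A^f\text{ wins }\mathsf{Game}^R]-\tfrac12\Bigr|,\qquad \Delta_A(R)=\max_{f:[L]\to\{\pm1\}}\Delta_A(R\mid f),\qquad \Delta_A^{\mathrm{avg}}=\mathop{\mathbb E}_{R}[\Delta_A(R)],$$ where $R:[K]\times[N]\to\{\pm1\}$ is uniformly random. **Lemma (upper tail for $\Delta_A(R)$).** There exists an absolute constant $c>0$ such that for all $n,m,\ell,t,K$ as above, every $t$-query adversary $A=(n,m,\ell,U_1,\dots,U_{t+1})$ and every real $\epsilon\ge0$, $$\Pr_{R}\bigl[\Delta_A(R)\ge \Delta_A^{\mathrm{avg}}+\epsilon\bigr]\le 4\exp\bigl(-c\,\epsilon^2KN\bigr),$$ where $R:[K]\times[N]\to\{\pm1\}$ is uniformly random. -/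

import Mathlib

open scoped BigOperators

noncomputable section

namespace OracleGame

/-- Bit strings of length `m`. They index the standard basis of the space of `m` qubits, whose
dimension is `2 ^ m`; coordinate `0` is the first qubit. -/
abbrev Bits (m : ℕ) : Type := Fin m → Fin 2

/-- Boolean functions on `ℓ` bits, with values in `{1, -1}` (the units of `ℤ`). -/
abbrev BoolFun (ℓ : ℕ) : Type := Bits ℓ → ℤˣ

/-- Function families `R : [K] × [N] → {1, -1}` with `N = 2 ^ n`, written as `k ↦ R k`. -/
abbrev FunFamily (K n : ℕ) : Type := Fin K → BoolFun n

/-- The first `k` bits of a string of `m` bits. -/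
def firstBits {k m : ℕ} (h : k ≤ m) (x : Bits m) : Bits k := fun i => x (Fin.castLE h i)

/-- The standard basis state `|x⟩`. -/
def basisState {n : ℕ} (x : Bits n) : Bits n → ℂ := Pi.single x 1

/-- The binary phase state `|ψ_h⟩ = N ^ (-1/2) ∑ x, h x |x⟩` with `N = 2 ^ n`. -/
def phaseState {n : ℕ} (h : BoolFun n) : Bits n → ℂ :=
  fun x => ((h x : ℤ) : ℂ) / ((Real.sqrt ((2 : ℝ) ^ n) : ℝ) : ℂ)

/-- The phase oracle of `f` on the first `ℓ` of `m` qubits: `|x⟩ ↦ f (x₁ … x_ℓ) |x⟩`. -/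
def phaseOracle {ℓ m : ℕ} (h : ℓ ≤ m) (f : BoolFun ℓ) : Matrix (Bits m) (Bits m) ℂ :=
  Matrix.diagonal fun x => ((f (firstBits h x) : ℤ) : ℂ)

/-- The state `|ψ⟩ ⊗ |0 ^ (m - n)⟩`: the input sits on the first `n` qubits. -/
def withAncilla {n m : ℕ} (h : n ≤ m) (ψ : Bits n → ℂ) : Bits m → ℂ :=
  fun x => if ∀ j : Fin m, n ≤ (j : ℕ) → x j = 0 then ψ (firstBits h x) else 0

/-- A `t`-query oracle circuit `(n, m, ℓ, U₁, …, U_{t+1})`: `n` input qubits, `m` qubits in total,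
phase queries of input length `ℓ`, and unitaries on `m` qubits (indexed from `0` here). -/
structure OracleCircuit (n m ℓ t : ℕ) where
  input_le : n ≤ m
  query_le : ℓ ≤ m
  U : Fin (t + 1) → Matrix.unitaryGroup (Bits m) ℂ

/-- The operator `U_{t+1} O_f U_t ⋯ O_f U_2 O_f U_1` on `m` qubits. -/
def OracleCircuit.operator {n m ℓ t : ℕ} (A : OracleCircuit n m ℓ t) (f : BoolFun ℓ) :
    Matrix (Bits m) (Bits m) ℂ :=
  Fin.induction (motive := fun _ => Matrix (Bits m) (Bits m) ℂ)
    (A.U 0 : Matrix (Bits m) (Bits m) ℂ)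
    (fun i V => (A.U i.succ : Matrix (Bits m) (Bits m) ℂ) * phaseOracle A.query_le f * V)
    (Fin.last t)

/-- The final state of `A ^ f` on input `|ψ⟩`. -/
def OracleCircuit.output {n m ℓ t : ℕ} (A : OracleCircuit n m ℓ t) (f : BoolFun ℓ)
    (ψ : Bits n → ℂ) : Bits m → ℂ :=
  (A.operator f).mulVec (withAncilla A.input_le ψ)

/-- An adversary is an oracle circuit with at least one qubit, the first of which is measured
in the standard basis at the end. -/
structure Adversary (n m ℓ t : ℕ) extends OracleCircuit n m ℓ t where
  one_le : 1 ≤ m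

namespace Adversary

variable {n m ℓ t K : ℕ}

/-- The probability that `A ^ f` outputs the bit `b` on the input state `|ψ⟩` (Born rule). -/
def outputProb (A : Adversary n m ℓ t) (f : BoolFun ℓ) (b : Fin 2) (ψ : Bits n → ℂ) : ℝ :=
  ∑ x : Bits m, if x ⟨0, A.one_le⟩ = b then ‖A.output f ψ x‖ ^ 2 else 0

/-- The probability that `A ^ f` wins the game on `R`. The challenger's bit is uniform. If it is
`0` the input is `|ψ_{R k}⟩` for uniform `k`; if it is `1` the input is `|x⟩` for uniform `x`.
The adversary wins if it outputs the challenger's bit. -/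
def winProb (A : Adversary n m ℓ t) (R : FunFamily K n) (f : BoolFun ℓ) : ℝ :=
  (1 / 2) * (𝔼 k : Fin K, A.outputProb f 0 (phaseState (R k))) +
    (1 / 2) * (𝔼 x : Bits n, A.outputProb f 1 (basisState x))

/-- The distinguishing advantage `Δ_A(R | f) = 2 |Pr[A ^ f wins on R] - 1/2|`. -/
def advantage (A : Adversary n m ℓ t) (R : FunFamily K n) (f : BoolFun ℓ) : ℝ :=
  2 * |A.winProb R f - 1 / 2|

/-- The maximum distinguishing advantage `Δ_A(R) = max_f Δ_A(R | f)`. -/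
def maxAdvantage (A : Adversary n m ℓ t) (R : FunFamily K n) : ℝ :=
  Finset.univ.sup' Finset.univ_nonempty fun f : BoolFun ℓ => A.advantage R f

/-- The average of `Δ_A(R)` over a uniformly random function family `R : [K] × [2 ^ n] → {1, -1}`. -/
def avgAdvantage (A : Adversary n m ℓ t) (K : ℕ) : ℝ :=
  𝔼 R : FunFamily K n, A.maxAdvantage R

end Adversary

/-- The probability of the event `E` under the uniform distribution on a finite type. -/
def uniformProb {α : Type} [Fintype α] (E : α → Prop) : ℝ :=
  (Nat.card {a : α // E a} : ℝ) / (Fintype.card α : ℝ)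

end OracleGame

end

/-! For fixed `f` and outcome `b`, the output probability on a phase state is `‖T v‖ ^ 2` with `T` a
linear contraction: a convex quadratic in the signs. Up to constants the maximal advantage is a
maximum over `f` and `b` of averages of these, so at each `R` it lies above a tangent of the active
piece. The slopes depend on `R`, but their squares always sum to at most `16 / (K * 2 ^ n)`, so no
union bound over `f` is needed.

One-sided control with point-dependent slopes is the setting of Talagrand's convex distance
inequality. Its dual form `exists_sum_exp_mul_sum_exp_neg_le` gives `G ≥ r F - r ^ 2 V / 2` with `𝔼
exp G * 𝔼 exp (-r F) ≤ 1`. Jensen on the second factor bounds the moment generating function of `F`,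
and Markov's inequality gives the tail. -/

/-! ### Convex distance inequality on the cube of signs -/

theorem Int.sum_units_eq_add_neg (σ : ℤˣ) (h : ℤˣ → ℝ) : ∑ s, h s = h σ + h (-σ) := by
  have h0 : ∑ s, h s = h 1 + h (-1) := by
    rw [show (Finset.univ : Finset ℤˣ) = {1, -1} from rfl]
    exact Finset.sum_pair (by decide)
  rcases Int.units_eq_one_or σ with rfl | rfl
  · exact h0
  · rw [h0, neg_neg, add_comm]

/-- The two-point inequality behind the induction over the coordinates of the cube. -/
theorem Real.one_add_exp_mul_one_add_exp_le_four {a : ℝ} (ha : 0 ≤ a) :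
    (1 + Real.exp (-a)) * (1 + Real.exp (a * (1 - min a 1) + (min a 1) ^ 2 / 2)) ≤ 4 := by
  -- Factoring out half exponents leaves two `cosh` terms; with `cosh x ≤ exp (x ^ 2 / 2)` the total
  -- exponent is `-u ^ 3 (4 - u) / 32`.
  have key : ∀ u : ℝ, 0 ≤ u → u ≤ 1 →
      (1 + Real.exp (-u)) * (1 + Real.exp (u - u ^ 2 / 2)) ≤ 4 := by
    intro u hu hu1
    have e1 : 1 + Real.exp (-u) = 2 * Real.exp (-u / 2) * Real.cosh (u / 2) := by
      rw [Real.cosh_eq, show -u / 2 = -(u / 2) by ring]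
      have h1 : Real.exp (-(u / 2)) * Real.exp (u / 2) = 1 := by
        rw [← Real.exp_add]; simp
      have h2 : Real.exp (-(u / 2)) * Real.exp (-(u / 2)) = Real.exp (-u) := by
        rw [← Real.exp_add]; congr 1; ring
      linear_combination -h1 - h2
    have e2 : ∀ v : ℝ, 1 + Real.exp v = 2 * Real.exp (v / 2) * Real.cosh (v / 2) := by
      intro v
      rw [Real.cosh_eq]
      have h1 : Real.exp (v / 2) * Real.exp (-(v / 2)) = 1 := by
        rw [← Real.exp_add]; simp
      have h2 : Real.exp (v / 2) * Real.exp (v / 2) = Real.exp v := by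
        rw [← Real.exp_add]; congr 1; ring
      linear_combination -h1 - h2
    rw [e1, e2]
    calc _ ≤ (2 * Real.exp (-u / 2) * Real.exp ((u / 2) ^ 2 / 2)) *
          (2 * Real.exp ((u - u ^ 2 / 2) / 2) * Real.exp (((u - u ^ 2 / 2) / 2) ^ 2 / 2)) := by
          gcongr <;> exact Real.cosh_le_exp_half_sq _
      _ = 4 * Real.exp (-u / 2 + (u / 2) ^ 2 / 2 +
          ((u - u ^ 2 / 2) / 2 + ((u - u ^ 2 / 2) / 2) ^ 2 / 2)) := by
          simp only [Real.exp_add]; ring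
      _ ≤ 4 * 1 := by
          gcongr
          rw [Real.exp_le_one_iff]
          have : 0 ≤ u ^ 3 * (4 - u) := mul_nonneg (by positivity) (by linarith)
          nlinarith
      _ = 4 := by norm_num
  rcases le_total a 1 with h | h
  · rw [min_eq_left h]
    convert key a ha h using 4
    ring
  · rw [min_eq_right h]
    refine le_trans ?_ (key 1 zero_le_one le_rfl)
    norm_num
    gcongr

/-- If `∑ exp G₀ ≤ exp u₀` and `∑ exp G₁ ≤ exp u₁`, the same holds for convex combinations. -/
theorem sum_exp_convex_combination_le {α : Type*} [Fintype α] {G₀ G₁ : α → ℝ} {u₀ u₁ l : ℝ}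
    (h₀ : ∑ x, Real.exp (G₀ x) ≤ Real.exp u₀) (h₁ : ∑ x, Real.exp (G₁ x) ≤ Real.exp u₁)
    (hl0 : 0 ≤ l) (hl1 : l ≤ 1) :
    ∑ x, Real.exp ((1 - l) * G₀ x + l * G₁ x) ≤ Real.exp ((1 - l) * u₀ + l * u₁) := by
  have n : ∀ {G : α → ℝ} {u : ℝ}, ∑ x, Real.exp (G x) ≤ Real.exp u →
      ∑ x, Real.exp (G x - u) ≤ 1 := by
    intro G u h
    simp only [Real.exp_sub]
    rw [← Finset.sum_div]
    exact (div_le_one (Real.exp_pos _)).2 h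
  -- Once both sums are normalized to be at most 1, pointwise convexity of `exp` suffices.
  have h : ∑ x, Real.exp ((1 - l) * (G₀ x - u₀) + l * (G₁ x - u₁)) ≤ 1 := by
    calc _ ≤ ∑ x, ((1 - l) * Real.exp (G₀ x - u₀) + l * Real.exp (G₁ x - u₁)) :=
          Finset.sum_le_sum fun x _ => convexOn_exp.2 trivial trivial (by linarith) hl0 (by ring)
      _ = (1 - l) * ∑ x, Real.exp (G₀ x - u₀) + l * ∑ x, Real.exp (G₁ x - u₁) := by
          rw [Finset.sum_add_distrib, Finset.mul_sum, Finset.mul_sum]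
      _ ≤ (1 - l) * 1 + l * 1 :=
          add_le_add (mul_le_mul_of_nonneg_left (n h₀) (by linarith))
            (mul_le_mul_of_nonneg_left (n h₁) hl0)
      _ = 1 := by ring
  have e : ∀ x, Real.exp ((1 - l) * G₀ x + l * G₁ x) =
      Real.exp ((1 - l) * (G₀ x - u₀) + l * (G₁ x - u₁)) * Real.exp ((1 - l) * u₀ + l * u₁) := by
    intro x
    rw [← Real.exp_add]; congr 1; ring
  simp only [e]
  rw [← Finset.sum_mul]
  exact mul_le_of_le_one_left (Real.exp_pos _).le h

/-- A dual form of Talagrand's convex distance inequality on the cube of signs, after Maurey. -/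
theorem exists_sum_exp_mul_sum_exp_neg_le (d : ℕ) : ∀ F : (Fin d → ℤˣ) → ℝ,
    ∃ G : (Fin d → ℤˣ) → ℝ,
      (∑ x, Real.exp (G x)) * (∑ x, Real.exp (-F x)) ≤ 4 ^ d ∧
      ∀ (x : Fin d → ℤˣ) (a : Fin d → ℝ) (c : ℝ),
        (∀ y, c - ∑ i, (if y i ≠ x i then a i else 0) ≤ F y) → c - (∑ i, a i ^ 2) / 2 ≤ G x := by
  induction d with
  | zero =>
    intro F
    refine ⟨F, ?_, fun x a c h => by simpa using h x⟩
    simp [← Real.exp_add]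
  | succ d ih =>
    intro F
    choose G hG hGF using fun s : ℤˣ => ih fun x => F (Fin.cons s x)
    set A : ℤˣ → ℝ := fun s => ∑ x, Real.exp (-F (Fin.cons s x)) with hA
    have hApos : ∀ s, 0 < A s := fun s =>
      Finset.sum_pos (fun _ _ => Real.exp_pos _) Finset.univ_nonempty
    -- `σ` is the half-cube where `F` is lower in the exponential sense; the other half borrows from
    -- it.
    obtain ⟨σ, hσ⟩ : ∃ σ, A (-σ) ≤ A σ := by
      rcases le_total (A (-1)) (A 1) with h | h
      · exact ⟨1, h⟩
      · exact ⟨-1, by simpa using h⟩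
    set a := Real.log (A σ) - Real.log (A (-σ)) with ha
    have ha0 : 0 ≤ a := sub_nonneg.2 (Real.log_le_log (hApos _) hσ)
    -- Minimizes `a * (1 - l) + l ^ 2 / 2` over `[0, 1]`.
    set l := min a 1 with hl
    have hl0 : 0 ≤ l := le_min ha0 zero_le_one
    have hl1 : l ≤ 1 := min_le_right _ _
    have hB : ∀ s, ∑ x, Real.exp (G s x) ≤ Real.exp (Real.log (4 ^ d) - Real.log (A s)) := by
      intro s
      rw [Real.exp_sub, Real.exp_log (by positivity), Real.exp_log (hApos s), le_div_iff₀ (hApos s)]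
      exact hG s
    have hsum : ∀ h : (Fin (d + 1) → ℤˣ) → ℝ, ∑ x, h x =
        ∑ x, h (Fin.cons σ x) + ∑ x, h (Fin.cons (-σ) x) := by
      intro h
      rw [← (Fin.consEquiv fun _ => ℤˣ).sum_comp, Fintype.sum_prod_type,
        Int.sum_units_eq_add_neg σ]
      rfl
    have hne : -σ ≠ σ := by
      rcases Int.units_eq_one_or σ with rfl | rfl <;> decide
    refine ⟨fun x => if x 0 = σ then G σ (Fin.tail x) else
      (1 - l) * G (-σ) (Fin.tail x) + l * G σ (Fin.tail x) + l ^ 2 / 2, ?_, ?_⟩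
    · rw [hsum, hsum]
      simp only [Fin.cons_zero, Fin.tail_cons, if_true, if_neg hne]
      have h1 := sum_exp_convex_combination_le (hB (-σ)) (hB σ) hl0 hl1
      have h2 : ∑ x, Real.exp ((1 - l) * G (-σ) x + l * G σ x + l ^ 2 / 2) ≤
          4 ^ d / A σ * Real.exp (a * (1 - l) + l ^ 2 / 2) := by
        simp only [Real.exp_add _ (l ^ 2 / 2)]
        rw [← Finset.sum_mul]
        refine (mul_le_mul_of_nonneg_right h1 (Real.exp_pos _).le).trans_eq ?_
        rw [← Real.exp_add]
        have : 4 ^ d / A σ = Real.exp (Real.log (4 ^ d) - Real.log (A σ)) := by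
          rw [Real.exp_sub, Real.exp_log (by positivity), Real.exp_log (hApos _)]
        rw [this, ← Real.exp_add, ← Real.exp_add, ha]
        congr 1; ring
      have h3 : ∑ x, Real.exp (G σ x) ≤ 4 ^ d / A σ := by
        rw [le_div_iff₀ (hApos σ)]; exact hG σ
      have h4 : A (-σ) = A σ * Real.exp (-a) := by
        rw [ha, neg_sub, Real.exp_sub, Real.exp_log (hApos _), Real.exp_log (hApos _)]
        field_simp [(hApos σ).ne']
      change _ * (A σ + A (-σ)) ≤ _
      calc _ ≤ (4 ^ d / A σ + 4 ^ d / A σ * Real.exp (a * (1 - l) + l ^ 2 / 2)) *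
            (A σ + A (-σ)) :=
            mul_le_mul_of_nonneg_right (add_le_add h3 h2) (add_pos (hApos _) (hApos _)).le
        _ = 4 ^ d * ((1 + Real.exp (-a)) * (1 + Real.exp (a * (1 - l) + l ^ 2 / 2))) := by
            rw [h4]; field_simp [(hApos σ).ne']
        _ ≤ 4 ^ d * 4 := by
            gcongr; exact Real.one_add_exp_mul_one_add_exp_le_four ha0
        _ = 4 ^ (d + 1) := by ring
    · intro x b c h
      -- On the half-cube `s`, the cost of flipping coordinate 0 is absorbed into the constant `c`.
      have hc : ∀ s, (c - if s ≠ x 0 then b 0 else 0) - (∑ i, Fin.tail b i ^ 2) / 2 ≤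
          G s (Fin.tail x) := by
        intro s
        refine hGF s _ _ _ fun y => ?_
        have := h (Fin.cons s y)
        rw [Fin.sum_univ_succ] at this
        simp only [Fin.cons_zero, Fin.cons_succ] at this
        rw [sub_sub]
        exact this
      have hs : ∑ i, b i ^ 2 = b 0 ^ 2 + ∑ i, Fin.tail b i ^ 2 := Fin.sum_univ_succ _
      rw [hs]
      dsimp only
      split_ifs with h0
      · have := hc σ
        rw [h0] at this
        simp at this
        nlinarith [sq_nonneg (b 0)]
      · have hx : x 0 = -σ := by
          rcases Int.units_eq_one_or σ with rfl | rfl <;>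
            rcases Int.units_eq_one_or (x 0) with h' | h' <;> simp_all
        have h1 := hc σ
        have h2 := hc (-σ)
        rw [hx] at h1 h2
        rw [if_pos hne.symm] at h1
        simp only [ne_eq, not_true_eq_false, if_false] at h2
        -- Interpolation costs `l * b 0`, and `l * b 0 - l ^ 2 / 2 ≤ b 0 ^ 2 / 2`.
        nlinarith [mul_le_mul_of_nonneg_left h1 hl0,
          mul_le_mul_of_nonneg_left h2 (sub_nonneg.2 hl1), sq_nonneg (b 0 - l)]

/-! ### Exponential moments and the upper tail -/

/-- Upper tail of a function on the cube of signs that is bounded below, from each of its points,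
by a linear function of the flipped coordinates. -/
theorem OracleGame.uniformProb_mean_add_le {ι : Type} [Fintype ι] [DecidableEq ι] {F : (ι → ℤˣ) → ℝ}
    {V : ℝ} (hV : 0 < V)
    (hF : ∀ x, ∃ a : ι → ℝ, ∑ i, a i ^ 2 ≤ V ∧
      ∀ y, F x - ∑ i, (if y i ≠ x i then a i else 0) ≤ F y) {ε : ℝ} (hε : 0 ≤ ε) :
    uniformProb (fun x => (𝔼 y, F y) + ε ≤ F x) ≤ Real.exp (-(ε ^ 2 / (2 * V))) := by
  set e := Fintype.equivFin ι
  set D : ℝ := (Fintype.card (ι → ℤˣ) : ℝ) with hD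
  have hDpos : 0 < D := by rw [hD]; exact_mod_cast Fintype.card_pos
  have hD2 : (4 : ℝ) ^ Fintype.card ι = D ^ 2 := by
    rw [hD, Fintype.card_fun, Fintype.card_units_int]
    push_cast
    rw [← pow_mul, mul_comm, pow_mul]; norm_num
  -- Minimizes the Chernoff exponent `r ^ 2 * V / 2 - r * ε`.
  set r := ε / V
  have hr : 0 ≤ r := by positivity
  obtain ⟨G, hG, hGF⟩ := exists_sum_exp_mul_sum_exp_neg_le (Fintype.card ι)
    fun x => r * F (x ∘ e)
  have hre : ∀ h : (ι → ℤˣ) → ℝ, ∑ x : Fin (Fintype.card ι) → ℤˣ, h (x ∘ e) = ∑ x, h x :=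
    fun h => (e.symm.arrowCongr (Equiv.refl ℤˣ)).sum_comp h
  have hGF' : ∀ x, r * F (x ∘ e) - r ^ 2 * V / 2 ≤ G x := by
    intro x
    obtain ⟨a, ha, hy⟩ := hF (x ∘ e)
    have := hGF x (fun i => r * a (e.symm i)) (r * F (x ∘ e)) fun y => by
      have h1 := mul_le_mul_of_nonneg_left (hy (y ∘ e)) hr
      rw [mul_sub, Finset.mul_sum, ← e.symm.sum_comp] at h1
      simpa [mul_ite] using h1
    rw [e.symm.sum_comp fun i => (r * a i) ^ 2] at this
    simp only [mul_pow] at this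
    rw [← Finset.mul_sum] at this
    nlinarith [mul_le_mul_of_nonneg_left ha (sq_nonneg r)]
  set μ := 𝔼 y, F y with hμ
  have hmean : D * Real.exp (-(r * μ)) ≤ ∑ x, Real.exp (-(r * F x)) := by
    have hj := convexOn_exp.map_sum_le (t := Finset.univ) (w := fun _ : ι → ℤˣ => 1 / D)
      (p := fun x => -(r * F x)) (fun _ _ => by positivity)
      (by simp [hD]) (fun _ _ => trivial)
    simp only [smul_eq_mul] at hj
    rw [← Finset.mul_sum, ← Finset.mul_sum, Finset.sum_neg_distrib, ← Finset.mul_sum] at hj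
    have : 1 / D * -(r * ∑ x, F x) = -(r * μ) := by
      rw [hμ, Fintype.expect_eq_sum_div_card, ← hD]; ring
    rw [this] at hj
    calc _ ≤ D * (1 / D * ∑ x, Real.exp (-(r * F x))) := by gcongr
      _ = _ := by field_simp
  have hmgf : ∑ x, Real.exp (r * F x) ≤ D * Real.exp (r * μ + r ^ 2 * V / 2) := by
    have h1 : ∑ x, Real.exp (r * F x) ≤ Real.exp (r ^ 2 * V / 2) * ∑ x, Real.exp (G x) := by
      rw [← hre, Finset.mul_sum]
      refine Finset.sum_le_sum fun x _ => ?_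
      rw [← Real.exp_add]
      exact Real.exp_le_exp.2 (by linarith [hGF' x])
    have h2 : (∑ x, Real.exp (G x)) * (D * Real.exp (-(r * μ))) ≤ D ^ 2 := by
      rw [← hD2]
      refine le_trans (mul_le_mul_of_nonneg_left hmean
        (Finset.sum_nonneg fun _ _ => (Real.exp_pos _).le)) ?_
      rw [← hre]
      exact hG
    have h3 : ∑ x, Real.exp (G x) ≤ D * Real.exp (r * μ) := by
      rw [Real.exp_neg] at h2
      have hp := Real.exp_pos (r * μ)
      field_simp at h2
      nlinarith
    calc _ ≤ _ := h1
      _ ≤ Real.exp (r ^ 2 * V / 2) * (D * Real.exp (r * μ)) := by gcongr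
      _ = _ := by rw [Real.exp_add]; ring
  rw [uniformProb, ← hD, div_le_iff₀ hDpos, Nat.card_eq_fintype_card, Fintype.card_subtype]
  have hmarkov : ((Finset.univ.filter fun x => μ + ε ≤ F x).card : ℝ) * Real.exp (r * (μ + ε)) ≤
      ∑ x, Real.exp (r * F x) := by
    rw [← nsmul_eq_mul, ← Finset.sum_const]
    refine le_trans (Finset.sum_le_sum fun x hx => ?_)
      (Finset.sum_le_sum_of_subset_of_nonneg (Finset.filter_subset _ _)
        fun _ _ _ => (Real.exp_pos _).le)
    exact Real.exp_le_exp.2 (mul_le_mul_of_nonneg_left (Finset.mem_filter.1 hx).2 hr)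
  have hfin := hmarkov.trans hmgf
  rw [← le_div_iff₀ (Real.exp_pos _), mul_div_assoc, ← Real.exp_sub] at hfin
  refine hfin.trans_eq ?_
  rw [mul_comm]
  congr 2
  simp only [r]
  field_simp
  ring

/-! ### Norm preservation by the circuit -/

namespace OracleGame

theorem phaseOracle_mem_unitaryGroup {ℓ m : ℕ} (h : ℓ ≤ m) (f : BoolFun ℓ) :
    phaseOracle h f ∈ Matrix.unitaryGroup (Bits m) ℂ := by
  rw [Matrix.mem_unitaryGroup_iff, phaseOracle, Matrix.star_eq_conjTranspose,
    Matrix.diagonal_conjTranspose, Matrix.diagonal_mul_diagonal, ← Matrix.diagonal_one]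
  congr 1
  funext x
  rcases Int.units_eq_one_or (f (firstBits h x)) with h' | h' <;> simp [h']

theorem OracleCircuit.operator_mem_unitaryGroup {n m ℓ t : ℕ} (A : OracleCircuit n m ℓ t)
    (f : BoolFun ℓ) : A.operator f ∈ Matrix.unitaryGroup (Bits m) ℂ := by
  unfold OracleCircuit.operator
  induction Fin.last t using Fin.induction with
  | zero => exact (A.U 0).2
  | succ i ih =>
    rw [Fin.induction_succ]
    exact mul_mem (mul_mem (A.U i.succ).2 (phaseOracle_mem_unitaryGroup _ _)) ih

theorem sum_norm_sq_mulVec_of_mem_unitaryGroup {ι : Type*} [Fintype ι] [DecidableEq ι]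
    {U : Matrix ι ι ℂ} (hU : U ∈ Matrix.unitaryGroup ι ℂ) (v : ι → ℂ) :
    ∑ x, ‖U.mulVec v x‖ ^ 2 = ∑ x, ‖v x‖ ^ 2 := by
  have h : ∀ w : ι → ℂ, ((∑ x, ‖w x‖ ^ 2 : ℝ) : ℂ) = dotProduct (star w) w := by
    intro w
    push_cast
    exact Finset.sum_congr rfl fun x _ => (Complex.conj_mul' (w x)).symm
  have : ((∑ x, ‖U.mulVec v x‖ ^ 2 : ℝ) : ℂ) = ((∑ x, ‖v x‖ ^ 2 : ℝ) : ℂ) := by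
    rw [h, h, Matrix.star_mulVec, Matrix.dotProduct_mulVec, Matrix.vecMul_vecMul,
      ← Matrix.star_eq_conjTranspose, Matrix.mem_unitaryGroup_iff'.1 hU, Matrix.vecMul_one]
  exact_mod_cast this

theorem sum_norm_sq_withAncilla {n m : ℕ} (h : n ≤ m) (ψ : Bits n → ℂ) :
    ∑ x, ‖withAncilla h ψ x‖ ^ 2 = ∑ x, ‖ψ x‖ ^ 2 := by
  symm
  refine Finset.sum_bij_ne_zero
    (fun x _ _ => fun j : Fin m => if hj : (j : ℕ) < n then x ⟨j, hj⟩ else 0)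
    (fun _ _ _ => Finset.mem_univ _) ?_ ?_ ?_
  · intro x _ _ y _ _ hxy
    funext i
    have := congrFun hxy (Fin.castLE h i)
    simpa using this
  · intro z _ hz
    have hz' : ∀ j : Fin m, n ≤ (j : ℕ) → z j = 0 := by
      by_contra hc
      exact hz (by simp [withAncilla, if_neg hc])
    refine ⟨firstBits h z, Finset.mem_univ _, ?_, ?_⟩
    · simpa [withAncilla, if_pos hz'] using hz
    · funext j
      split_ifs with hj
      · rfl
      · exact (hz' j (not_lt.1 hj)).symm
  · intro x _ _
    rw [withAncilla, if_pos]
    · congr 3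
      funext i
      simp [firstBits]
    · intro j hj
      simp [not_lt.2 hj]

theorem sum_norm_sq_phaseState {n : ℕ} (h : BoolFun n) : ∑ x, ‖phaseState h x‖ ^ 2 = 1 := by
  have : ∀ x, ‖phaseState h x‖ ^ 2 = 1 / 2 ^ n := by
    intro x
    rw [phaseState, norm_div, div_pow, Complex.norm_real, Real.norm_eq_abs, sq_abs,
      Real.sq_sqrt (by positivity)]
    rcases Int.units_eq_one_or (h x) with h' | h' <;> simp [h']
  simp [this]

namespace Adversary

variable {n m ℓ t K : ℕ}

theorem sum_norm_sq_output (A : Adversary n m ℓ t) (f : BoolFun ℓ) (ψ : Bits n → ℂ) :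
    ∑ x, ‖A.output f ψ x‖ ^ 2 = ∑ x, ‖ψ x‖ ^ 2 := by
  rw [OracleCircuit.output,
    sum_norm_sq_mulVec_of_mem_unitaryGroup (A.operator_mem_unitaryGroup f),
    sum_norm_sq_withAncilla]

theorem outputProb_zero_add_outputProb_one (A : Adversary n m ℓ t) (f : BoolFun ℓ)
    (ψ : Bits n → ℂ) : A.outputProb f 0 ψ + A.outputProb f 1 ψ = ∑ x, ‖ψ x‖ ^ 2 := by
  rw [← A.sum_norm_sq_output f, outputProb, outputProb, ← Finset.sum_add_distrib]
  refine Finset.sum_congr rfl fun x _ => ?_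
  generalize x ⟨0, A.one_le⟩ = b
  fin_cases b <;> simp

/-- The final state of `A ^ f`, projected to the outcomes in which the bit `b` is measured. -/
def project (A : Adversary n m ℓ t) (f : BoolFun ℓ) (b : Fin 2) :
    EuclideanSpace ℂ (Bits n) →ₗ[ℂ] EuclideanSpace ℂ (Bits m) where
  toFun ψ := WithLp.toLp 2 fun x => if x ⟨0, A.one_le⟩ = b then A.output f ψ.ofLp x else 0
  map_add' ψ φ := by
    have : withAncilla A.input_le (ψ + φ).ofLp =
        withAncilla A.input_le ψ.ofLp + withAncilla A.input_le φ.ofLp := by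
      funext x
      simp only [withAncilla, Pi.add_apply, PiLp.add_apply]
      split_ifs <;> simp
    ext x
    simp only [OracleCircuit.output, this, Matrix.mulVec_add, PiLp.add_apply, Pi.add_apply]
    split_ifs <;> simp
  map_smul' c ψ := by
    have : withAncilla A.input_le (c • ψ).ofLp = c • withAncilla A.input_le ψ.ofLp := by
      funext x
      simp only [withAncilla, Pi.smul_apply, PiLp.smul_apply]
      split_ifs <;> simp
    ext x
    simp only [OracleCircuit.output, this, Matrix.mulVec_smul, PiLp.smul_apply, Pi.smul_apply,
      RingHom.id_apply]
    split_ifs <;> simp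

theorem norm_sq_project (A : Adversary n m ℓ t) (f : BoolFun ℓ) (b : Fin 2) (ψ : Bits n → ℂ) :
    ‖A.project f b (WithLp.toLp 2 ψ)‖ ^ 2 = A.outputProb f b ψ := by
  rw [EuclideanSpace.norm_sq_eq, outputProb]
  refine Finset.sum_congr rfl fun x _ => ?_
  simp only [project, LinearMap.coe_mk, AddHom.coe_mk]
  split_ifs <;> simp

theorem norm_project_le (A : Adversary n m ℓ t) (f : BoolFun ℓ) (b : Fin 2)
    (ψ : EuclideanSpace ℂ (Bits n)) : ‖A.project f b ψ‖ ≤ ‖ψ‖ := by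
  refine le_of_sq_le_sq ?_ (norm_nonneg _)
  rw [show ψ = WithLp.toLp 2 ψ.ofLp from rfl, norm_sq_project, EuclideanSpace.norm_sq_eq,
    ← A.sum_norm_sq_output f, outputProb]
  refine Finset.sum_le_sum fun x _ => ?_
  split_ifs
  · exact le_rfl
  · positivity

/-! ### Tangent lower bounds for the advantage -/

/-- `outputProb` at phase states is bounded below by a linear function of the flipped signs. -/
theorem exists_outputProb_phaseState_sub_le (A : Adversary n m ℓ t) (f : BoolFun ℓ) (b : Fin 2)
    (h : BoolFun n) : ∃ a : Bits n → ℝ, ∑ i, a i ^ 2 ≤ 16 / 2 ^ n ∧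
      ∀ g : BoolFun n, A.outputProb f b (phaseState h) - ∑ i, (if g i ≠ h i then a i else 0) ≤
        A.outputProb f b (phaseState g) := by
  set T := (A.project f b).toContinuousLinearMap with hT
  have hTn : ‖T‖ ≤ 1 := T.opNorm_le_bound zero_le_one fun ψ => by
    rw [one_mul]; exact A.norm_project_le f b ψ
  set v : BoolFun n → EuclideanSpace ℂ (Bits n) := fun g => WithLp.toLp 2 (phaseState g) with hv
  have hTv : ∀ g, ‖T (v g)‖ ^ 2 = A.outputProb f b (phaseState g) :=
    fun g => A.norm_sq_project f b _
  have hvn : ‖v h‖ = 1 := by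
    rw [← sq_eq_sq₀ (norm_nonneg _) zero_le_one, EuclideanSpace.norm_sq_eq, one_pow]
    exact sum_norm_sq_phaseState h
  set z := T.adjoint (T (v h)) with hz
  have hzn : ‖z‖ ≤ 1 := by
    calc ‖z‖ ≤ ‖T.adjoint‖ * (‖T‖ * ‖v h‖) :=
          (T.adjoint.le_opNorm _).trans
            (mul_le_mul_of_nonneg_left (T.le_opNorm _) (norm_nonneg _))
      _ ≤ 1 * (1 * 1) := by
          rw [hvn, LinearIsometryEquiv.norm_map]
          gcongr
      _ = 1 := by norm_num
  set s := Real.sqrt ((2 : ℝ) ^ n) with hs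
  have hs0 : 0 < s := Real.sqrt_pos.2 (by positivity)
  have hs2 : s ^ 2 = 2 ^ n := Real.sq_sqrt (by positivity)
  have hsq : ∀ i, (((h i : ℤ) : ℝ)) ^ 2 = 1 := fun i => by
    rcases Int.units_eq_one_or (h i) with h' | h' <;> simp [h']
  -- The derivative of `‖T v‖ ^ 2` at `v h` is `2 Re ⟨z, ·⟩`, and flipping sign `i` moves `v h` by
  -- `-2 h i / s` in coordinate `i`.
  refine ⟨fun i => 4 * ((h i : ℤ) : ℝ) * (z i).re / s, ?_, fun g => ?_⟩
  · have e : ∀ i, (4 * ((h i : ℤ) : ℝ) * (z i).re / s) ^ 2 = 16 / 2 ^ n * (z i).re ^ 2 := by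
      intro i
      rw [div_pow, mul_pow, mul_pow, hsq, hs2]; ring
    simp only [e]
    rw [← Finset.mul_sum]
    refine mul_le_of_le_one_right (by positivity) ?_
    calc ∑ i, (z i).re ^ 2 ≤ ∑ i, ‖z i‖ ^ 2 := by
          refine Finset.sum_le_sum fun i _ => ?_
          rw [← sq_abs]
          gcongr
          exact Complex.abs_re_le_norm _
      _ = ‖z‖ ^ 2 := (EuclideanSpace.norm_sq_eq z).symm
      _ ≤ 1 := pow_le_one₀ (norm_nonneg _) hzn
  · have hexp : ‖T (v g)‖ ^ 2 = ‖T (v h)‖ ^ 2 + 2 * (inner ℂ z (v g - v h)).re +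
        ‖T (v g - v h)‖ ^ 2 := by
      rw [hz, ContinuousLinearMap.adjoint_inner_left]
      have := @norm_add_sq ℂ _ _ _ _ (T (v h)) (T (v g - v h))
      rw [← map_add, add_sub_cancel] at this
      exact this
    have hin : 2 * (inner ℂ z (v g - v h)).re =
        -∑ i, (if g i ≠ h i then 4 * ((h i : ℤ) : ℝ) * (z i).re / s else 0) := by
      rw [PiLp.inner_apply, Complex.re_sum, Finset.mul_sum, ← Finset.sum_neg_distrib]
      refine Finset.sum_congr rfl fun i _ => ?_
      have hvi : (v g - v h) i = (((((g i : ℤ) : ℝ) - ((h i : ℤ) : ℝ)) / s : ℝ) : ℂ) := by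
        simp only [hv, PiLp.sub_apply, phaseState, ← hs]
        push_cast
        ring
      rw [hvi, RCLike.inner_apply, Complex.re_ofReal_mul, Complex.conj_re]
      rcases Int.units_eq_one_or (h i) with h' | h' <;>
        rcases Int.units_eq_one_or (g i) with h'' | h'' <;> simp [h', h''] <;> ring
    rw [← hTv, ← hTv, hexp, hin]
    -- Convexity enters here: the second-order term is dropped.
    nlinarith [sq_nonneg ‖T (v g - v h)‖]

end Adversary
end OracleGame

namespace OracleGame
namespace Adversary

variable {n m ℓ t K : ℕ}

/-- The advantage is the maximum over `b` of an affine function of the mean of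
`A.outputProb f b` at the phase states of the family. -/
theorem exists_advantage_eq (A : Adversary n m ℓ t) (hK : 1 ≤ K) (f : BoolFun ℓ) :
    ∃ C : Fin 2 → ℝ,
      (∀ (R : FunFamily K n) b,
        (𝔼 k, A.outputProb f b (phaseState (R k))) + C b ≤ A.advantage R f) ∧
      ∀ R : FunFamily K n, ∃ b,
        A.advantage R f = (𝔼 k, A.outputProb f b (phaseState (R k))) + C b := by
  set q := 𝔼 x : Bits n, A.outputProb f 1 (basisState x) with hq
  have hne : (Finset.univ : Finset (Fin K)).Nonempty := ⟨⟨0, hK⟩, Finset.mem_univ _⟩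
  have hsum : ∀ R : FunFamily K n, (𝔼 k, A.outputProb f 0 (phaseState (R k))) +
      (𝔼 k, A.outputProb f 1 (phaseState (R k))) = 1 := by
    intro R
    rw [← Finset.expect_add_distrib]
    simp only [outputProb_zero_add_outputProb_one, sum_norm_sq_phaseState]
    exact Finset.expect_const hne 1
  have hadv : ∀ R : FunFamily K n, A.advantage R f =
      |(𝔼 k, A.outputProb f 0 (phaseState (R k))) + (q - 1)| := by
    intro R
    rw [advantage, winProb, ← hq]
    nth_rewrite 1 [← abs_of_pos (two_pos : (0 : ℝ) < 2)]
    rw [← abs_mul]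
    congr 1; ring
  -- The two branches of the absolute value; the outcome probabilities sum to 1, so the negative
  -- branch is affine in the mean for `b = 1`.
  refine ⟨![q - 1, -q], fun R b => ?_, fun R => ?_⟩
  · rw [hadv]
    fin_cases b
    · exact le_abs_self _
    · refine le_trans (le_of_eq ?_) (neg_le_abs _)
      simp
      linarith [hsum R]
  · rw [hadv]
    rcases abs_choice ((𝔼 k, A.outputProb f 0 (phaseState (R k))) + (q - 1)) with h | h
    · exact ⟨0, h⟩
    · refine ⟨1, h.trans ?_⟩
      simp
      linarith [hsum R]

/-- Freezing the `f` and `b` optimal at `R` gives equality at `R` and a lower bound at every `S`.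
Averaging over `k` divides slopes by `K`, so the `K` blocks contribute `K * (16 / 2 ^ n) / K ^ 2`.
-/
theorem exists_maxAdvantage_sub_le (A : Adversary n m ℓ t) (hK : 1 ≤ K) (R : FunFamily K n) :
    ∃ a : Fin K × Bits n → ℝ, ∑ i, a i ^ 2 ≤ 16 / (K * 2 ^ n) ∧
      ∀ S : FunFamily K n, A.maxAdvantage R -
        ∑ i, (if S i.1 i.2 ≠ R i.1 i.2 then a i else 0) ≤ A.maxAdvantage S := by
  have hK0 : (0 : ℝ) < K := by exact_mod_cast hK
  obtain ⟨f, -, hf⟩ := Finset.exists_mem_eq_sup' (Finset.univ_nonempty (α := BoolFun ℓ))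
    fun f => A.advantage R f
  obtain ⟨C, hle, heq⟩ := A.exists_advantage_eq hK f
  obtain ⟨b, hb⟩ := heq R
  choose a ha hS using fun k => A.exists_outputProb_phaseState_sub_le f b (R k)
  refine ⟨fun i => a i.1 i.2 / K, ?_, fun S => ?_⟩
  · simp only [Fintype.sum_prod_type, div_pow, ← Finset.sum_div]
    calc (∑ k, ∑ i, a k i ^ 2) / (K : ℝ) ^ 2 ≤
        (∑ _k : Fin K, (16 / 2 ^ n : ℝ)) / (K : ℝ) ^ 2 := by
          gcongr with k _
          exact ha k
      _ = 16 / ((K : ℝ) * 2 ^ n) := by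
          simp
          field_simp
  · have h1 : A.advantage S f ≤ A.maxAdvantage S :=
      Finset.le_sup' (fun f => A.advantage S f) (Finset.mem_univ f)
    have h2 : A.maxAdvantage R = A.advantage R f := hf
    refine le_trans ?_ ((hle S b).trans h1)
    rw [h2, hb]
    have h3 : (𝔼 k, A.outputProb f b (phaseState (R k))) -
        ∑ i : Fin K × Bits n, (if S i.1 i.2 ≠ R i.1 i.2 then a i.1 i.2 / K else 0) ≤
        𝔼 k, A.outputProb f b (phaseState (S k)) := by
      rw [Fintype.expect_eq_sum_div_card, Fintype.expect_eq_sum_div_card, Fintype.card_fin,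
        Fintype.sum_prod_type]
      have e : ∀ k, ∑ i, (if S k i ≠ R k i then a k i / K else 0) =
          (∑ i, (if S k i ≠ R k i then a k i else 0)) / (K : ℝ) := by
        intro k
        rw [Finset.sum_div]
        exact Finset.sum_congr rfl fun i _ => by split_ifs <;> simp
      simp only [e]
      rw [← Finset.sum_div, ← sub_div, ← Finset.sum_sub_distrib]
      gcongr with k _
      exact hS k (S k)
    linarith

end Adversary

theorem uniformProb_comp_equiv {α β : Type} [Fintype α] [Fintype β] (e : α ≃ β) (E : β → Prop) :
    uniformProb (fun a => E (e a)) = uniformProb E := by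
  rw [uniformProb, uniformProb, Fintype.card_congr e,
    Nat.card_congr (e.subtypeEquiv (p := fun a => E (e a)) (q := E) fun _ => Iff.rfl)]

end OracleGame

theorem mainTheorem4 :
    ∃ c : ℝ, 0 < c ∧
      ∀ (n m ℓ t K : ℕ) (A : OracleGame.Adversary n m ℓ t), 1 ≤ K → ∀ ε : ℝ, 0 ≤ ε →
        OracleGame.uniformProb (fun R : OracleGame.FunFamily K n =>
            A.avgAdvantage K + ε ≤ A.maxAdvantage R) ≤
          4 * Real.exp (-(c * ε ^ 2 * ((K : ℝ) * (2 : ℝ) ^ n))) := by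
  -- `ε ^ 2 / (2 * V)` with `V = 16 / (K * 2 ^ n)` gives `1 / 32`; the prefactor 4 is slack.
  refine ⟨1 / 32, by norm_num, fun n m ℓ t K A hK ε hε => ?_⟩
  have hK0 : (0 : ℝ) < K := by exact_mod_cast hK
  let e : (Fin K × OracleGame.Bits n → ℤˣ) ≃ OracleGame.FunFamily K n := Equiv.curry _ _ _
  have hmean : A.avgAdvantage K = 𝔼 x, A.maxAdvantage (e x) :=
    (Fintype.expect_equiv e _ _ fun _ => rfl).symm
  rw [← OracleGame.uniformProb_comp_equiv e, hmean]
  have h := OracleGame.uniformProb_mean_add_le (F := fun x => A.maxAdvantage (e x))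
    (V := 16 / (K * 2 ^ n)) (by positivity) (fun x => by
      obtain ⟨a, ha, hS⟩ := A.exists_maxAdvantage_sub_le hK (e x)
      exact ⟨a, ha, fun y => hS (e y)⟩) hε
  refine h.trans (le_trans (le_of_eq ?_) (le_mul_of_one_le_left (Real.exp_pos _).le (by norm_num)))
  congr 2
  field_simp
  ring
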